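/- A Hausdorff topological group $(G,\mathcal T)$ with identity $0$ has the small subgroup generating property (SSGP) if for every neighbourhood $U$ of $0$ there is a family $\mathcal H$ of subgroups of $G$, each contained in $U$, such that the subgroup generated by $\bigcup\mathcal H$ is dense in $G$. An abelian group $G$ admits an SSGP topology if there is a Hausdorff group topology on $G$ with this property. For a set $P$ of primes, let $\mathbb Q_P$ be the subgroup of $\mathbb Q$ consisting of the fractions whose reduced denominator has all its prime factors in $P$. For a group $G$ and an infinite cardinal $\lambda$, $G^{(\lambda)}$ denotes the direct sum and $G^\lambda$ the direct product of $\lambda$ copies of $G$. **Theorem.** The following abelian groups admit an SSGP topology: (a) $\mathbb Q$, and $\mathbb Q_P$ for every infinite set $P$ of primes; (b) $\mathbb Q/\mathbb Z$, and $\mathbb Q_P/\mathbb Z$ for every infinite set $P$ of primes; (c) $\bigoplus_{i<\omega}\mathbb Z_{p_i}$, where the $p_i$ are primes that either all coincide or are pairwise distinct; (d) $\mathbb Z^{(\omega)}$; (e) $\mathbb Z^{\omega}$; (f) $G^{(\lambda)}$ for every abelian group $G$ with $|G|>1$ and every cardinal $\lambda\ge\omega$; (g) $F^{\lambda}$ for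 every finite abelian group $F$ with $|F|>1$ and every cardinal $\lambda\ge\omega$; (h) $\bigoplus_{i\in I}G_i$ and $\prod_{i\in I}G_i$ for every family $(G_i)_{i\in I}$ of abelian groups each of which admits an SSGP topology. -/

import Mathlib

open Topology DirectSum

universe u₁ u₂ u₃ u₄ u₅ u₆

/-- The small subgroup generating property of a topological group, in additive notation: for each
neighbourhood `U` of `0` there is a family `𝓗` of subgroups contained in `U` whose union generates
a dense subgroup. -/
def IsSSGP (G : Type*) [AddGroup G] [TopologicalSpace G] : Prop :=
  ∀ U ∈ 𝓝 (0 : G), ∃ 𝓗 : Set (AddSubgroup G),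
    (∀ H ∈ 𝓗, (H : Set G) ⊆ U) ∧
      Dense ((AddSubgroup.closure (⋃ H ∈ 𝓗, (H : Set G)) : AddSubgroup G) : Set G)

/-- The (abstract) group `G` admits an SSGP topology: there is a Hausdorff group topology on `G`
with the small subgroup generating property. (A Hausdorff group topology is automatically
completely regular.) -/
def AdmitsSSGP (G : Type*) [AddGroup G] : Prop :=
  ∃ _ : TopologicalSpace G, IsTopologicalAddGroup G ∧ T2Space G ∧ IsSSGP G

/-- For a set `P` of primes, the subgroup of `ℚ` of all fractions whose reduced denominator
has all its prime factors in `P`; the primes outside `P` are excluded from denominators, and the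
primes in `P` are allowed together with all their powers. -/
def ratDenomIn (P : Set ℕ) : AddSubgroup ℚ where
  carrier := {q | ∀ p : ℕ, p.Prime → p ∣ q.den → p ∈ P}
  zero_mem' := by
    intro p hp h
    exact absurd (Nat.dvd_one.mp h) hp.ne_one
  add_mem' := by
    intro a b ha hb p hp h
    rcases (Nat.Prime.dvd_mul hp).mp (h.trans (Rat.add_den_dvd a b)) with h | h
    · exact ha p hp h
    · exact hb p hp h
  neg_mem' := by
    intro a ha p hp h
    exact ha p hp (by simpa using h)

/-!
Let `B` be a bounded group and give the step functions on `[0, ∞)` with values in `B` the topology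
of the `L¹` norm. Every step function is a sum of step functions `b · 1_[a, c)` with `c - a` small,
and all the multiples of such a function are small. Hence a group of step functions with rational
break points has the small subgroup generating property as soon as, for every rational interval, the
values `b` for which it contains `b · 1_[a, c)` are dense in `B`.

For discrete `B` these groups of step functions are direct sums of copies of `B`; powers of finite
cyclic groups have this form by Nöbeling's theorem. Torsion-free groups of infinite rank are spread
over the intervals through a basis of their divisible hull and an injective homomorphism from `ℚ` to
the circle which is dense on `ℤ`. Direct sums of cyclic groups of coprime orders and the groups
`ℚ_P/ℤ` embed into a direct sum of circles so that the coordinates of every element have coprime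
orders. When each coordinate is attached to an interval, a coordinate can be isolated by taking a
multiple, so several coordinates may share an interval; attaching infinitely many to each interval
gives dense sets of values. Finally, the topologies that `ℚ_P` inherits from `ℚ_P/ℤ` through the
maps `x ↦ p⁻ᵏ x + ℤ`, with `p ∈ P` fixed, have a Hausdorff supremum.
-/

section Permanence

section SmallSubgroups

variable {G H : Type*} [AddGroup G] [AddGroup H]

/-- The subgroup generated by all subgroups contained in the set `U`. It is encoded through its
cyclic subgroups, and the small subgroup generating property says that it is dense whenever `U` is
a neighbourhood of `0`. -/
def smallGen (U : Set G) : AddSubgroup G :=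
  AddSubgroup.closure {x | (AddSubgroup.zmultiples x : Set G) ⊆ U}

theorem smallGen_mono {U V : Set G} (h : U ⊆ V) : smallGen U ≤ smallGen V :=
  AddSubgroup.closure_mono fun _ hx => hx.trans h

theorem le_smallGen {K : AddSubgroup G} {U : Set G} (h : (K : Set G) ⊆ U) : K ≤ smallGen U :=
  fun _ hx => AddSubgroup.subset_closure
    ((SetLike.coe_subset_coe.2 (AddSubgroup.zmultiples_le_of_mem hx)).trans h)

theorem map_smallGen_preimage (φ : G →+ H) (U : Set H) :
    (smallGen (φ ⁻¹' U)).map φ = smallGen (U ∩ φ.range) := by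
  rw [smallGen, smallGen, AddMonoidHom.map_closure]
  congr 1
  ext y
  simp only [Set.mem_image, Set.mem_ofPred_eq, ← Set.image_subset_iff, ← AddSubgroup.coe_map,
    AddMonoidHom.map_zmultiples, Set.subset_inter_iff, SetLike.coe_subset_coe,
    AddSubgroup.zmultiples_le, AddMonoidHom.mem_range]
  constructor
  · rintro ⟨x, hx, rfl⟩
    exact ⟨hx, x, rfl⟩
  · rintro ⟨hy, x, rfl⟩
    exact ⟨x, hy, rfl⟩

theorem isSSGP_iff [TopologicalSpace G] :
    IsSSGP G ↔ ∀ U ∈ 𝓝 (0 : G), Dense (smallGen U : Set G) := by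
  refine forall₂_congr fun U _ => ⟨?_, fun h => ?_⟩
  · rintro ⟨𝓗, h𝓗, hdense⟩
    exact hdense.mono <| (AddSubgroup.closure_le _).2 <|
      Set.iUnion₂_subset fun K hK => le_smallGen (h𝓗 K hK)
  · refine ⟨{K | (K : Set G) ⊆ U}, fun _ => id, h.mono (AddSubgroup.closure_mono fun x hx => ?_)⟩
    exact Set.mem_biUnion hx (AddSubgroup.mem_zmultiples x)

theorem isSSGP_iff_of_isInducing [TopologicalSpace G] [TopologicalSpace H] {φ : G →+ H}
    (hφ : IsInducing φ) :
    IsSSGP G ↔ ∀ U ∈ 𝓝 (0 : H), (φ.range : Set H) ⊆ closure (smallGen (U ∩ φ.range)) := by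
  have hU (U : Set H) : Dense (smallGen (φ ⁻¹' U) : Set G) ↔
      (φ.range : Set H) ⊆ closure (smallGen (U ∩ φ.range)) := by
    rw [hφ.dense_iff, ← map_smallGen_preimage, AddSubgroup.coe_map, AddMonoidHom.coe_range,
      Set.range_subset_iff]
  simp only [← hU, isSSGP_iff, hφ.nhds_eq_comap, map_zero]
  refine ⟨fun h U hU => h _ (Filter.preimage_mem_comap hU), fun h V ⟨U, hU, hUV⟩ => ?_⟩
  exact (h U hU).mono (smallGen_mono hUV)

theorem isSSGP_coe_iff [TopologicalSpace G] {S : AddSubgroup G} :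
    IsSSGP S ↔ ∀ U ∈ 𝓝 (0 : G), (S : Set G) ⊆ closure (smallGen (U ∩ S)) := by
  simpa only [AddSubgroup.range_subtype] using
    isSSGP_iff_of_isInducing (φ := S.subtype) IsInducing.subtypeVal

theorem IsSSGP.of_denseRange [TopologicalSpace G] [TopologicalSpace H] (hG : IsSSGP G)
    {φ : G →+ H} (hφ : Continuous φ) (hdense : DenseRange φ) : IsSSGP H := by
  rw [isSSGP_iff] at hG ⊢
  intro U hU
  have hU' : φ ⁻¹' U ∈ 𝓝 0 := hφ.continuousAt.preimage_mem_nhds (by rwa [map_zero])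
  refine (hdense.dense_image hφ (hG _ hU')).mono ?_
  rw [← AddSubgroup.coe_map, map_smallGen_preimage]
  exact smallGen_mono Set.inter_subset_left

theorem IsSSGP.range [TopologicalSpace G] [TopologicalSpace H] (hG : IsSSGP G)
    {φ : G →+ H} (hφ : Continuous φ) : IsSSGP φ.range :=
  hG.of_denseRange (φ := φ.rangeRestrict) (hφ.subtype_mk _) φ.rangeRestrict_surjective.denseRange

theorem IsSSGP.top [TopologicalSpace G] (hG : IsSSGP G) : IsSSGP (⊤ : AddSubgroup G) :=
  hG.of_denseRange (φ := (AddMonoidHom.id G).codRestrict ⊤ fun _ => trivial)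
    (continuous_id.subtype_mk _) (Function.Surjective.denseRange fun x => ⟨x, rfl⟩)

theorem IsSSGP.of_le_closure_iSup [TopologicalSpace G] [IsTopologicalAddGroup G] {ι : Sort*}
    {K : ι → AddSubgroup G} {T : AddSubgroup G} (hK : ∀ i, IsSSGP (K i)) (hKT : ∀ i, K i ≤ T)
    (hT : T ≤ (⨆ i, K i).topologicalClosure) : IsSSGP T := by
  refine isSSGP_coe_iff.2 fun U hU => ?_
  suffices T ≤ (smallGen (U ∩ T)).topologicalClosure from this
  refine hT.trans ?_
  refine AddSubgroup.topologicalClosure_minimal _ (iSup_le fun i => ?_)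
    (AddSubgroup.isClosed_topologicalClosure _)
  exact (isSSGP_coe_iff.1 (hK i) U hU).trans
    (closure_mono (smallGen_mono (Set.inter_subset_inter_right U (hKT i))))

theorem IsSSGP.iInf_of_directed {ι : Type*} [Nonempty ι] {t : ι → TopologicalSpace G}
    (ht : Directed (· ≥ ·) t) (hs : ∀ i, @IsSSGP G _ (t i)) : @IsSSGP G _ (⨅ i, t i) := by
  have mem_nhds_iff (x : G) (U : Set G) : U ∈ @nhds G (⨅ i, t i) x ↔ ∃ i, U ∈ @nhds G (t i) x := by
    rw [nhds_iInf, Filter.mem_iInf_of_directed]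
    exact fun i j => (ht i j).imp fun _ => And.imp nhds_mono nhds_mono
  refine (@isSSGP_iff G _ (⨅ i, t i)).2 fun U hU x => ?_
  refine (@mem_closure_iff_nhds G (⨅ i, t i) _ _).2 fun V hV => ?_
  obtain ⟨i, hi⟩ := (mem_nhds_iff 0 U).1 hU
  obtain ⟨j, hj⟩ := (mem_nhds_iff x V).1 hV
  obtain ⟨k, hki, hkj⟩ := ht i j
  exact (@mem_closure_iff_nhds G (t k) _ _).1
    ((@isSSGP_iff G _ (t k)).1 (hs k) U (nhds_mono hki hi) x) V (nhds_mono hkj hj)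

end SmallSubgroups

theorem AdmitsSSGP.of_injective {G H : Type*} [AddGroup G] [AddGroup H] [TopologicalSpace H]
    [IsTopologicalAddGroup H] [T2Space H] {φ : G →+ H} (hφ : Function.Injective φ)
    (h : IsSSGP φ.range) : AdmitsSSGP G := by
  let : TopologicalSpace G := .induced φ inferInstance
  have hφ' : IsEmbedding φ := ⟨⟨rfl⟩, hφ⟩
  exact ⟨inferInstance, topologicalAddGroup_induced φ, hφ'.t2Space,
    (isSSGP_iff_of_isInducing hφ'.isInducing).2 (isSSGP_coe_iff.1 h)⟩

theorem AdmitsSSGP.of_addEquiv {G H : Type*} [AddGroup G] [AddGroup H] (e : G ≃+ H)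
    (hH : AdmitsSSGP H) : AdmitsSSGP G := by
  obtain ⟨_, _, _, hs⟩ := hH
  refine .of_injective (φ := e.toAddMonoidHom) e.injective ?_
  rw [AddMonoidHom.range_eq_top.2 e.surjective]
  exact hs.top

section Pi

variable {I : Type*} {H : I → Type*} [∀ i, AddCommGroup (H i)] [∀ i, TopologicalSpace (H i)]

theorem pi_mem_of_single_mem [DecidableEq I] {C : AddSubgroup (∀ i, H i)}
    (hC : IsClosed (C : Set (∀ i, H i))) {h : ∀ i, H i} (hh : ∀ i, Pi.single i (h i) ∈ C) :
    h ∈ C := by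
  have hsum : HasSum (fun i => (Pi.single i (h i) : ∀ j, H j)) h := by
    refine Pi.hasSum.2 fun j => ?_
    simpa using hasSum_single (f := fun i => (Pi.single i (h i) : ∀ j, H j) j) j
      fun i hij => Pi.single_eq_of_ne hij.symm _
  exact hC.mem_of_tendsto hsum (.of_forall fun s => C.sum_mem fun i _ => hh i)

variable [∀ i, IsTopologicalAddGroup (H i)]

theorem IsSSGP.of_le_pi_closure [DecidableEq I] {L : ∀ i, AddSubgroup (H i)}
    {T : AddSubgroup (∀ i, H i)} (hL : ∀ i, IsSSGP (L i))
    (hLT : ∀ i, ∀ x ∈ L i, Pi.single i x ∈ T) (hT : ∀ h ∈ T, ∀ i, h i ∈ closure (L i : Set (H i))) :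
    IsSSGP T := by
  let ι (i : I) : H i →+ ∀ j, H j := AddMonoidHom.single H i
  have hι (i : I) : Continuous (ι i) := continuous_single i
  refine .of_le_closure_iSup (K := fun i => ((ι i).comp (L i).subtype).range)
    (fun i => (hL i).range ((hι i).comp continuous_subtype_val)) ?_ fun h hh => ?_
  · rintro i _ ⟨x, rfl⟩
    exact hLT i x x.2
  · refine pi_mem_of_single_mem (AddSubgroup.isClosed_topologicalClosure _) fun i => ?_
    refine map_mem_closure (hι i) (hT h hh i) fun x hx => ?_
    exact le_iSup (fun i => ((ι i).comp (L i).subtype).range) i ⟨⟨x, hx⟩, rfl⟩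

theorem IsSSGP.of_single_mem [DecidableEq I] (hH : ∀ i, IsSSGP (H i)) {T : AddSubgroup (∀ i, H i)}
    (hT : ∀ i x, Pi.single i x ∈ T) : IsSSGP T :=
  .of_le_pi_closure (L := fun _ => ⊤) (fun i => (hH i).top) (fun i x _ => hT i x)
    fun _ _ _ => subset_closure trivial

end Pi

theorem AdmitsSSGP.pi {I : Type*} {G : I → Type*} [∀ i, AddCommGroup (G i)]
    (hG : ∀ i, AdmitsSSGP (G i)) : AdmitsSSGP (∀ i, G i) := by
  classical
  choose _ _ _ hs using hG
  exact .of_injective (φ := .id _) Function.injective_id (.of_single_mem hs fun _ _ => ⟨_, rfl⟩)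

theorem AdmitsSSGP.directSum {I : Type*} {G : I → Type*} [∀ i, AddCommGroup (G i)]
    (hG : ∀ i, AdmitsSSGP (G i)) : AdmitsSSGP (⨁ i, G i) := by
  classical
  choose _ _ _ hs using hG
  refine .of_injective (φ := DirectSum.coeFnAddMonoidHom G) DFunLike.coe_injective
    (.of_single_mem hs fun i x => ?_)
  exact ⟨DirectSum.of G i x, DFinsupp.single_eq_pi_single⟩

/- The topologies induced by the homomorphisms `f k` become finer as `k` grows, because `n • ·` is
continuous on `H`; their supremum is Hausdorff. -/
theorem AdmitsSSGP.of_tower {G H : Type*} [AddGroup G] [AddCommGroup H] (hH : AdmitsSSGP H)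
    {f : ℕ → G →+ H} (hf : ∀ k, Function.Surjective (f k)) (n : ℕ)
    (hfn : ∀ k g, f k g = n • f (k + 1) g) (hsep : ∀ g ≠ 0, ∃ k, f k g ≠ 0) : AdmitsSSGP G := by
  obtain ⟨_, _, _, hs⟩ := hH
  let t (k : ℕ) : TopologicalSpace G := .induced (f k) inferInstance
  have ht : Antitone t := by
    refine antitone_nat_of_succ_le fun k => ?_
    have hcomp : t k = .induced (f (k + 1)) (.induced (n • ·) inferInstance) := by
      rw [induced_compose]
      exact congrArg (TopologicalSpace.induced · _) (funext (hfn k))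
    rw [hcomp]
    exact induced_mono (continuous_nsmul n).le_induced
  have hst (k : ℕ) : @IsSSGP G _ (t k) := by
    refine (@isSSGP_iff_of_isInducing _ _ _ _ (t k) _ (f k) (@IsInducing.mk _ _ (t k) _ _ rfl)).2 ?_
    rw [AddMonoidHom.range_eq_top.2 (hf k)]
    exact isSSGP_coe_iff.1 hs.top
  let : TopologicalSpace G := ⨅ k, t k
  have : IsTopologicalAddGroup G := topologicalAddGroup_iInf fun k => topologicalAddGroup_induced _
  refine ⟨inferInstance, inferInstance, ?_, .iInf_of_directed ht.directed_ge hst⟩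
  refine .of_injective_continuous (f := fun g k => f k g) ?_ ?_
  · refine (injective_iff_map_eq_zero (AddMonoidHom.pi f)).2 fun g hg => ?_
    by_contra hg0
    obtain ⟨k, hk⟩ := hsep g hg0
    exact hk (congrFun hg k)
  · exact continuous_pi fun k => continuous_iff_le_induced.2 (iInf_le t k)

theorem AdmitsSSGP.of_quotient {G : Type*} [AddCommGroup G] {N : AddSubgroup G}
    (hN : AdmitsSSGP (G ⧸ N)) {n : ℕ} (hn : Function.Bijective (n • · : G → G))
    (hsep : ∀ g, (∀ k, ∃ x ∈ N, n ^ k • x = g) → g = 0) : AdmitsSSGP G := by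
  let e (k : ℕ) : G ≃+ G := .ofBijective (nsmulAddMonoidHom (n ^ k)) <| by
    rw [show ⇑(nsmulAddMonoidHom (α := G) (n ^ k)) = (n • ·)^[k] from (smul_iterate n k).symm]
    exact hn.iterate k
  have he (k : ℕ) (g : G) : n ^ k • (e k).symm g = g := (e k).apply_symm_apply g
  refine .of_tower hN (f := fun k => (QuotientAddGroup.mk' N).comp (e k).symm.toAddMonoidHom)
    (fun k => (QuotientAddGroup.mk'_surjective N).comp (e k).symm.surjective) n (fun k g => ?_)
    fun g hg => ?_
  · refine (congrArg (QuotientAddGroup.mk' N) ((e k).symm_apply_eq.2 ?_)).trans (map_nsmul _ n _)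
    calc g = n ^ (k + 1) • (e (k + 1)).symm g := (he _ g).symm
      _ = n ^ k • n • (e (k + 1)).symm g := by rw [pow_succ, mul_smul]
  · by_contra! hmem
    exact hg (hsep g fun k => ⟨_, (QuotientAddGroup.eq_zero_iff _).1 (hmem k), he k g⟩)

end Permanence

section Step

open MeasureTheory

open scoped NNRat

theorem sub_mem_of_forall_sub_mem {K A : Type*} [Semifield K] [LinearOrder K]
    [IsStrictOrderedRing K] [Archimedean K] [AddCommGroup A] {F : K → A} {C : AddSubgroup A} {ε : K}
    (hε : 0 < ε) (h : ∀ a d, 0 < d → d < ε → F (a + d) - F a ∈ C) {c : K} (hc : 0 < c) :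
    F c - F 0 ∈ C := by
  obtain ⟨n, hn⟩ := exists_nat_gt (c / ε)
  have hn0 : (0 : K) < n := (div_pos hc hε).trans hn
  have hd : c / n < ε := (div_lt_comm₀ hε hn0).1 hn
  have htel : ∑ j ∈ Finset.range n, (F ((j + 1 : ℕ) * (c / n)) - F (j * (c / n))) = F c - F 0 := by
    rw [Finset.sum_range_sub (fun j : ℕ => F (j * (c / n))), mul_div_cancel₀ c hn0.ne']
    simp only [Nat.cast_zero, zero_mul]
  rw [← htel]
  refine C.sum_mem fun j _ => ?_
  rw [Nat.cast_succ, add_one_mul]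
  exact h _ _ (div_pos hc hn0) hd

variable {B : Type*} [NormedAddCommGroup B]

/-- The step function equal to `b` on `[0, q)` and to `0` elsewhere, as an element of the group of
integrable functions. -/
noncomputable def step (q : ℝ) : B →+ Lp B 1 (volume : Measure ℝ) :=
  .mk' (fun b => indicatorConstLp 1 measurableSet_Ico (measure_Ico_lt_top (a := 0) (b := q)).ne b)
    fun _ _ => indicatorConstLp_add.symm

theorem coeFn_step (q : ℝ) (b : B) : step q b =ᵐ[volume] (Set.Ico 0 q).indicator fun _ => b :=
  indicatorConstLp_coeFn (hs := measurableSet_Ico) (hμs := measure_Ico_lt_top.ne)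

theorem norm_step (q : ℝ) (b : B) : ‖step q b‖ = max q 0 * ‖b‖ := by
  rw [step, AddMonoidHom.mk'_apply, norm_indicatorConstLp one_ne_zero ENNReal.one_ne_top]
  simp [mul_comm]

theorem norm_step_sub_step {a c : ℝ} (ha : 0 ≤ a) (hac : a ≤ c) (b : B) :
    ‖step c b - step a b‖ = (c - a) * ‖b‖ := by
  have hsplit : step c b = step a b +
      indicatorConstLp 1 measurableSet_Ico (measure_Ico_lt_top (a := a) (b := c)).ne b := by
    simp only [step, AddMonoidHom.mk'_apply, ← Set.Ico_union_Ico_eq_Ico ha hac]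
    exact indicatorConstLp_disjoint_union measurableSet_Ico measurableSet_Ico measure_Ico_lt_top.ne
      measure_Ico_lt_top.ne (Set.Ico_disjoint_Ico_same) b
  rw [hsplit, add_sub_cancel_left, norm_indicatorConstLp one_ne_zero ENNReal.one_ne_top]
  simp [hac, mul_comm]

theorem step_zero (b : B) : step 0 b = 0 := by
  simp [← norm_eq_zero, norm_step]

theorem continuous_step (q : ℝ) : Continuous (step q : B →+ Lp B 1 volume) :=
  AddMonoidHomClass.continuous_of_bound _ (max q 0) fun b => (norm_step q b).le

/-- The group of step functions with rational break points and values in `B₀`, generated by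
`step q b` with `b` in `B₀` and `q > 0` rational. -/
noncomputable def stepGroup (B₀ : AddSubgroup B) : AddSubgroup (Lp B 1 (volume : Measure ℝ)) :=
  ⨆ q : {q : ℚ≥0 // 0 < q}, B₀.map (step (q : ℚ≥0))

theorem step_mem_stepGroup {B₀ : AddSubgroup B} (q : ℚ≥0) {b : B} (hb : b ∈ B₀) :
    step q b ∈ stepGroup B₀ := by
  rcases eq_zero_or_pos q with rfl | hq
  · rw [NNRat.cast_zero, step_zero]
    exact zero_mem _
  · exact le_iSup (fun q : {q : ℚ≥0 // 0 < q} => B₀.map (step (q : ℚ≥0))) ⟨q, hq⟩ ⟨b, hb, rfl⟩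

/- A difference `step c b - step a b` with `c - a` small is small whatever its value `b` is, hence
so are its multiples, and every step function is a sum of such differences. -/
theorem IsSSGP.of_dense_step_sub_step [BoundedSpace B]
    {S : AddSubgroup (Lp B 1 (volume : Measure ℝ))}
    (hS : S ≤ (stepGroup ⊤).topologicalClosure)
    (h : ∀ a c : ℚ≥0, a < c → Dense {b : B | step c b - step a b ∈ S}) : IsSSGP S := by
  refine isSSGP_coe_iff.2 fun U hU => ?_
  let C : AddSubgroup (Lp B 1 (volume : Measure ℝ)) := (smallGen (U ∩ S)).topologicalClosure
  have hC : IsClosed (C : Set (Lp B 1 (volume : Measure ℝ))) :=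
    AddSubgroup.isClosed_topologicalClosure (smallGen (U ∩ S))
  suffices stepGroup ⊤ ≤ C from hS.trans (AddSubgroup.topologicalClosure_minimal _ this hC)
  obtain ⟨r, hr, hrU⟩ := Metric.mem_nhds_iff.1 hU
  obtain ⟨M, hM, hMB⟩ := (Bornology.IsBounded.all (Set.univ : Set B)).exists_pos_norm_le
  obtain ⟨ε, hε, hεr⟩ : ∃ ε : ℚ≥0, 0 < ε ∧ ε * M < r := by
    obtain ⟨ε, hε, hεr⟩ := exists_rat_btwn (div_pos hr hM)
    lift ε to ℚ≥0 using by exact_mod_cast hε.le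
    exact ⟨ε, by exact_mod_cast hε, by exact_mod_cast (lt_div_iff₀ hM).1 hεr⟩
  have hshort (b : B) (a d : ℚ≥0) (hd : 0 < d) (hdε : d < ε) :
      step (a + d : ℚ≥0) b - step a b ∈ C := by
    have hcont : Continuous fun b : B => step (a + d : ℚ≥0) b - step a b :=
      (continuous_step _).sub (continuous_step _)
    refine (h a (a + d) (lt_add_of_pos_right a hd)).induction (fun b hb => ?_)
      (hC.preimage hcont) b
    refine AddSubgroup.le_topologicalClosure _ (AddSubgroup.subset_closure ?_)
    rintro _ ⟨n, rfl⟩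
    refine ⟨hrU (mem_ball_zero_iff.2 ?_), S.zsmul_mem hb n⟩
    calc ‖n • (step (a + d : ℚ≥0) b - step a b)‖
        = d * ‖n • b‖ := by
          rw [smul_sub, ← map_zsmul, ← map_zsmul, norm_step_sub_step a.cast_nonneg
            (NNRat.cast_le.2 le_self_add), NNRat.cast_add, add_sub_cancel_left]
      _ ≤ ε * M := by gcongr; exact hMB _ trivial
      _ < r := hεr
  refine iSup_le fun q => ?_
  rintro _ ⟨b, -, rfl⟩
  simpa [step_zero] using sub_mem_of_forall_sub_mem hε (hshort b) q.2

theorem stepGroup_top_le_topologicalClosure {B₀ : AddSubgroup B} (hB₀ : Dense (B₀ : Set B)) :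
    stepGroup ⊤ ≤ (stepGroup B₀).topologicalClosure := by
  refine iSup_le fun q => ?_
  rintro _ ⟨b, -, rfl⟩
  exact map_mem_closure (continuous_step _) (hB₀ b) fun _ => step_mem_stepGroup q

theorem isSSGP_stepGroup [BoundedSpace B] {B₀ : AddSubgroup B} (hB₀ : Dense (B₀ : Set B)) :
    IsSSGP (stepGroup B₀) := by
  refine .of_dense_step_sub_step ?_ fun a c _ => hB₀.mono fun b hb => ?_
  · exact (iSup_mono fun _ => AddSubgroup.map_mono le_top).trans
      (AddSubgroup.le_topologicalClosure _)
  · exact sub_mem (step_mem_stepGroup c hb) (step_mem_stepGroup a hb)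

/-- The homomorphism sending the function `f` with finite support to `∑ q, step q (f q)`. -/
noncomputable def stepSum : ({q : ℚ≥0 // 0 < q} →₀ B) →+ Lp B 1 (volume : Measure ℝ) :=
  Finsupp.liftAddHom fun q => step (q : ℚ≥0)

@[simp]
theorem stepSum_single (q : {q : ℚ≥0 // 0 < q}) (b : B) :
    stepSum (Finsupp.single q b) = step (q : ℚ≥0) b :=
  Finsupp.liftAddHom_apply_single _ _ _

theorem coeFn_stepSum (f : {q : ℚ≥0 // 0 < q} →₀ B) : stepSum f =ᵐ[volume]
    fun x => ∑ q ∈ f.support, (Set.Ico 0 ((q : ℚ≥0) : ℝ)).indicator (fun _ => f q) x := by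
  have hsum : stepSum f = ∑ q ∈ f.support, step (q : ℚ≥0) (f q) :=
    Finsupp.liftAddHom_apply _ _
  rw [hsum]
  filter_upwards [Lp.coeFn_fun_finsetSum f.support fun q => step (q : ℚ≥0) (f q),
    (Filter.eventually_all_finset f.support).2 fun q _ => coeFn_step ((q : ℚ≥0) : ℝ) (f q)]
    with x hx hstep
  rw [hx]
  exact Finset.sum_congr rfl hstep

/- Just to the left of the largest break point `m`, the function `∑ q, step q (f q)` has the value
`f m`. -/
theorem stepSum_injective : Function.Injective (stepSum (B := B)) := by
  refine (injective_iff_map_eq_zero _).2 fun f hf => ?_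
  by_contra hne
  obtain ⟨m, hm, hmax⟩ := f.support.exists_max_image id (Finsupp.support_nonempty_iff.2 hne)
  have hbelow (q : {q : ℚ≥0 // 0 < q}) (hq : q ∈ f.support) : ∀ᶠ x in 𝓝[<] ((m : ℚ≥0) : ℝ),
      (Set.Ico 0 ((q : ℚ≥0) : ℝ)).indicator (fun _ => f q) x = if q = m then f m else 0 := by
    split_ifs with hqm
    · have hm0 : (0 : ℝ) < (m : ℚ≥0) := by exact_mod_cast m.2
      filter_upwards [Ioo_mem_nhdsLT hm0] with x hx
      rw [hqm, Set.indicator_of_mem (Set.Ioo_subset_Ico_self hx)]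
    · have hlt : ((q : ℚ≥0) : ℝ) < (m : ℚ≥0) := by exact_mod_cast (hmax q hq).lt_of_ne hqm
      filter_upwards [Ioo_mem_nhdsLT hlt] with x hx
      exact Set.indicator_of_notMem (fun h => h.2.not_gt hx.1) _
  obtain ⟨l, hl, hlm⟩ := mem_nhdsLT_iff_exists_Ioo_subset.1
    ((Filter.eventually_all_finset f.support).2 hbelow)
  have hzero : ∀ᵐ x, ∑ q ∈ f.support,
      (Set.Ico 0 ((q : ℚ≥0) : ℝ)).indicator (fun _ => f q) x = 0 := by
    filter_upwards [coeFn_stepSum f, Lp.coeFn_zero B 1 (volume : Measure ℝ)] with x hx hx0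
    rw [← hx, hf, hx0, Pi.zero_apply]
  obtain ⟨x, hx0, hx⟩ := (Measure.dense_of_ae hzero).exists_between hl
  refine Finsupp.mem_support_iff.1 hm (Eq.trans ?_ hx0)
  rw [Finset.sum_congr rfl (hlm hx), Finset.sum_ite_eq', if_pos hm]

end Step

section FinitelySupported

open MeasureTheory Cardinal

open scoped NNRat

variable {I B : Type*} [NormedAddCommGroup B]

/-- The homomorphism applying `stepSum` to each row `f (i, ·)` of `f`. -/
noncomputable def stepSums :
    (I × {q : ℚ≥0 // 0 < q} →₀ B) →+ (I → Lp B 1 (volume : Measure ℝ)) :=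
  (stepSum.compLeft I).comp (Finsupp.coeFnAddHom.comp Finsupp.curryAddEquiv.toAddMonoidHom)

theorem stepSums_apply (f : I × {q : ℚ≥0 // 0 < q} →₀ B) (i : I) :
    stepSums f i = stepSum (f.curry i) :=
  rfl

theorem stepSums_single [DecidableEq I] (i : I) (q : {q : ℚ≥0 // 0 < q}) (b : B) :
    stepSums (Finsupp.single (i, q) b) = Pi.single i (step (q : ℚ≥0) b) := by
  ext1 j
  rw [stepSums_apply, Finsupp.curry_single]
  rcases eq_or_ne j i with rfl | hj
  · simp
  · simp [hj]

theorem stepSums_injective : Function.Injective (stepSums (I := I) (B := B)) :=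
  fun _ _ h => Finsupp.curryAddEquiv.injective <|
    DFunLike.coe_injective (funext fun i => stepSum_injective (congrFun h i))

theorem stepSum_mem_stepGroup (f : {q : ℚ≥0 // 0 < q} →₀ B) : stepSum f ∈ stepGroup ⊤ := by
  rw [stepSum, Finsupp.liftAddHom_apply]
  exact sum_mem fun q _ => step_mem_stepGroup q trivial

theorem nonempty_equiv_prod_of_countable (I Q : Type*) [Infinite I] [Countable Q] [Nonempty Q] :
    Nonempty (I ≃ I × Q) := by
  rw [← Cardinal.lift_mk_eq', Cardinal.mk_prod, Cardinal.lift_mul, Cardinal.lift_lift,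
    Cardinal.lift_lift, Cardinal.lift_umax, eq_comm]
  refine Cardinal.mul_eq_left (by simp) ?_ (by simp)
  exact (Cardinal.lift_le_aleph0.2 Cardinal.mk_le_aleph0).trans (by simp)

variable [BoundedSpace B]

theorem AdmitsSSGP.of_finsupp_prod {G : Type*} [AddCommGroup G] {B₀ : AddSubgroup B}
    (hB₀ : Dense (B₀ : Set B)) {φ : G →+ (I × {q : ℚ≥0 // 0 < q} →₀ B)}
    (hφ : Function.Injective φ) (hsingle : ∀ p, ∀ b ∈ B₀, Finsupp.single p b ∈ φ.range) :
    AdmitsSSGP G := by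
  classical
  refine .of_injective (φ := stepSums.comp φ) (stepSums_injective.comp hφ) ?_
  refine .of_le_pi_closure (L := fun _ => stepGroup B₀) (fun _ => isSSGP_stepGroup hB₀) ?_ ?_
  · intro i
    suffices stepGroup B₀ ≤ (stepSums.comp φ).range.comap
        (AddMonoidHom.single (fun _ => Lp B 1 (volume : Measure ℝ)) i) from fun x hx => this hx
    refine iSup_le fun q => ?_
    rintro _ ⟨b, hb, rfl⟩
    obtain ⟨g, hg⟩ := hsingle (i, q) b hb
    exact ⟨g, by rw [AddMonoidHom.comp_apply, hg, stepSums_single]; rfl⟩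
  · rintro _ ⟨g, rfl⟩ i
    exact stepGroup_top_le_topologicalClosure hB₀ (stepSum_mem_stepGroup _)

theorem AdmitsSSGP.of_finsupp [Infinite I] {G : Type*} [AddCommGroup G] {B₀ : AddSubgroup B}
    (hB₀ : Dense (B₀ : Set B)) {φ : G →+ (I →₀ B)} (hφ : Function.Injective φ)
    (hsingle : ∀ i, ∀ b ∈ B₀, Finsupp.single i b ∈ φ.range) : AdmitsSSGP G := by
  obtain ⟨e⟩ := nonempty_equiv_prod_of_countable I {q : ℚ≥0 // 0 < q}
  let e' : (I →₀ B) ≃+ _ := Finsupp.domCongr e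
  refine .of_finsupp_prod hB₀ (φ := e'.toAddMonoidHom.comp φ) (e'.injective.comp hφ) ?_
  intro p b hb
  obtain ⟨g, hg⟩ := hsingle (e.symm p) b hb
  refine ⟨g, ?_⟩
  rw [AddMonoidHom.comp_apply, hg]
  simp [e']

theorem admitsSSGP_finsupp (Λ G : Type*) [Infinite Λ] [AddCommGroup G] : AdmitsSSGP (Λ →₀ G) := by
  classical
  let : NormedAddCommGroup G := (1 : AddGroupNorm G).toNormedAddCommGroup
  have : BoundedSpace G := by
    refine ⟨isBounded_iff_forall_norm_le.2 ⟨1, fun g _ => ?_⟩⟩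
    exact ite_le_one zero_le_one le_rfl
  exact .of_finsupp (B₀ := (⊤ : AddSubgroup G)) dense_univ (φ := .id _) Function.injective_id
    fun i b _ => ⟨_, rfl⟩

end FinitelySupported

section TorsionFree

open Cardinal

/-- The homomorphism `r ↦ r√2` from `ℚ` to the circle. The irrational factor makes it injective,
and the image of `ℤ` dense. -/
noncomputable def ratToCircle : ℚ →+ UnitAddCircle :=
  (QuotientAddGroup.mk' _).comp ((AddMonoidHom.mulRight (√2 : ℝ)).comp
    (Rat.castHom ℝ).toAddMonoidHom)

theorem ratToCircle_apply (r : ℚ) : ratToCircle r = ((r * √2 : ℝ) : UnitAddCircle) := rfl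

theorem ratToCircle_injective : Function.Injective ratToCircle := by
  refine (injective_iff_map_eq_zero _).2 fun r hr => ?_
  rw [ratToCircle_apply, AddCircle.coe_eq_zero_iff] at hr
  obtain ⟨n, hn⟩ := hr
  by_contra hne
  exact (irrational_sqrt_two.ratCast_mul hne) ⟨n, by simpa using hn⟩

theorem dense_range_ratToCircle_intCast :
    Dense ((ratToCircle.comp (Int.castAddHom ℚ)).range : Set UnitAddCircle) := by
  refine (AddCircle.denseRange_zsmul_coe_iff.2
    (by simpa using irrational_sqrt_two)).mono (s₁ := Set.range (· • ((√2 : ℝ) : UnitAddCircle))) ?_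
  rintro _ ⟨n, rfl⟩
  exact ⟨n, by simp [ratToCircle_apply]⟩

/- A torsion-free group lies between `ℤ^(I)` and `ℚ^(I)` for a maximal independent family indexed by
`I`. -/
theorem admitsSSGP_of_aleph0_le_rank {G : Type*} [AddCommGroup G] [IsAddTorsionFree G]
    (hG : ℵ₀ ≤ Module.rank ℤ G) : AdmitsSSGP G := by
  have hspan : ⊤ ≤ Submodule.span ℚ (Set.range (DivisibleHull.coeAddMonoidHom G)) := by
    rintro x -
    induction x with | mk g n
    have hmk : DivisibleHull.mk g n = (n : ℚ)⁻¹ • (g : DivisibleHull G) := by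
      rw [eq_inv_smul_iff₀ (by simp), Nat.cast_smul_eq_nsmul, DivisibleHull.nsmul_mk]
      simp [DivisibleHull.mk_eq_mk_iff_smul_eq_smul]
    rw [hmk]
    exact Submodule.smul_mem _ _ (Submodule.subset_span ⟨g, rfl⟩)
  obtain ⟨I, b, hb⟩ : ∃ (I : Type _) (b : Module.Basis I ℚ (DivisibleHull G)),
      ∀ i, ∃ g : G, g = b i :=
    ⟨_, .ofSpan hspan, fun i => Module.Basis.ofSpan_subset hspan ⟨i, rfl⟩⟩
  have : Infinite I := by
    rw [Cardinal.infinite_iff, b.mk_eq_rank'', IsFractionRing.rank_right_eq ℤ ℚ]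
    exact hG.trans (LinearMap.rank_le_of_injective
      (DivisibleHull.coeAddMonoidHom G).toIntLinearMap DivisibleHull.coe_injective)
  let φ : G →+ (I →₀ UnitAddCircle) := (Finsupp.mapRange.addMonoidHom ratToCircle).comp
    (b.repr.toAddEquiv.toAddMonoidHom.comp (DivisibleHull.coeAddMonoidHom G))
  refine .of_finsupp dense_range_ratToCircle_intCast (φ := φ) ?_ ?_
  · exact (Finsupp.mapRange_injective _ (map_zero _) ratToCircle_injective).comp
      (b.repr.injective.comp DivisibleHull.coe_injective)
  · rintro i _ ⟨n, rfl⟩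
    obtain ⟨g, hg⟩ := hb i
    have hφ : φ g = Finsupp.single i (ratToCircle 1) := by simp [φ, hg]
    exact ⟨n • g, by rw [map_zsmul, hφ]; simp [← map_zsmul]⟩

end TorsionFree

section CoprimeCoordinates

open MeasureTheory

open scoped NNRat

variable {I B : Type*} [NormedAddCommGroup B]

/-- The homomorphism sending the function `f` with finite support to the sum over `i` of the step
functions with value `f i` on the interval `J i`. -/
noncomputable def intervalSum (J : I → ℚ≥0 × ℚ≥0) : (I →₀ B) →+ Lp B 1 (volume : Measure ℝ) :=
  Finsupp.liftAddHom fun i => step (J i).2 - step (J i).1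

@[simp]
theorem intervalSum_single (J : I → ℚ≥0 × ℚ≥0) (i : I) (b : B) :
    intervalSum J (Finsupp.single i b) = step (J i).2 b - step (J i).1 b :=
  Finsupp.liftAddHom_apply_single _ _ _

theorem intervalSum_mem_stepGroup (J : I → ℚ≥0 × ℚ≥0) (f : I →₀ B) :
    intervalSum J f ∈ stepGroup ⊤ := by
  rw [intervalSum, Finsupp.liftAddHom_apply]
  exact sum_mem fun i _ => sub_mem (step_mem_stepGroup _ trivial) (step_mem_stepGroup _ trivial)

theorem exists_nsmul_eq_single {A : Type*} [AddCommGroup A] {f : I →₀ A}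
    (hfin : ∀ i, IsOfFinAddOrder (f i))
    (hcop : Pairwise fun i j => (addOrderOf (f i)).Coprime (addOrderOf (f j))) (i : I) :
    ∃ N : ℕ, N • f = Finsupp.single i (f i) := by
  classical
  obtain ⟨N, hN⟩ := Nat.chineseRemainderOfFinset (Pi.single i 1) (fun j => addOrderOf (f j))
    f.support (fun j _ => (hfin j).addOrderOf_pos.ne') fun j _ k _ hjk => hcop hjk
  refine ⟨N, Finsupp.ext fun j => ?_⟩
  rw [Finsupp.smul_apply]
  by_cases hj : j ∈ f.support
  · rw [(hfin j).nsmul_eq_nsmul_iff_modEq.2 (hN j hj)]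
    rcases eq_or_ne j i with rfl | hji
    · simp
    · simp [hji]
  · rw [Finsupp.notMem_support_iff.1 hj, smul_zero, Finsupp.single_apply]
    split_ifs with h
    · rw [h, Finsupp.notMem_support_iff.1 hj]
    · rfl

theorem eq_zero_of_intervalSum_eq_zero {J : I → ℚ≥0 × ℚ≥0} (hJ : ∀ i, (J i).1 < (J i).2)
    {f : I →₀ B} (hfin : ∀ i, IsOfFinAddOrder (f i))
    (hcop : Pairwise fun i j => (addOrderOf (f i)).Coprime (addOrderOf (f j)))
    (hf : intervalSum J f = 0) : f = 0 := by
  ext i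
  obtain ⟨N, hN⟩ := exists_nsmul_eq_single hfin hcop i
  have hlt : ((J i).1 : ℝ) < (J i).2 := NNRat.cast_lt.2 (hJ i)
  have hnorm : ((J i).2 - (J i).1 : ℝ) * ‖f i‖ = 0 := by
    rw [← norm_step_sub_step (J i).1.cast_nonneg hlt.le, ← intervalSum_single, ← hN, map_nsmul, hf,
      smul_zero, norm_zero]
  simpa [(sub_pos.2 hlt).ne'] using hnorm

theorem dense_of_infinite_circle_addSubgroup {T : AddSubgroup UnitAddCircle}
    (hT : (T : Set UnitAddCircle).Infinite) : Dense (T : Set UnitAddCircle) := by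
  refine AddCircle.dense_addSubgroup_iff_ne_zmultiples.2 fun x hx hTx => hT ?_
  rw [hTx]
  exact finite_zmultiples.2 (addOrderOf_ne_zero_iff.1 hx)

/- Every interval is attached to infinitely many coordinates. Elements supported on one of these
coordinates supply infinitely many values on that interval, and an infinite subgroup of the circle
is dense. -/
theorem AdmitsSSGP.of_coprime_coordinates [Infinite I] {G : Type*} [AddCommGroup G]
    {X : G →+ (I →₀ UnitAddCircle)} (hX : Function.Injective X)
    (hfin : ∀ g i, IsOfFinAddOrder (X g i))
    (hcop : ∀ g, Pairwise fun i j => (addOrderOf (X g i)).Coprime (addOrderOf (X g j)))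
    (hsingle : ∀ i, ∃ t ≠ 0, Finsupp.single i t ∈ X.range) : AdmitsSSGP G := by
  have : Nonempty {J : ℚ≥0 × ℚ≥0 // J.1 < J.2} := ⟨⟨(0, 1), zero_lt_one⟩⟩
  obtain ⟨e⟩ := nonempty_equiv_prod_of_countable I {J : ℚ≥0 × ℚ≥0 // J.1 < J.2}
  let J (i : I) : ℚ≥0 × ℚ≥0 := (e i).2
  refine .of_injective (φ := (intervalSum J).comp X) ?_ (.of_dense_step_sub_step ?_ ?_)
  · exact (injective_iff_map_eq_zero _).2 fun g hg => (injective_iff_map_eq_zero X).1 hX g <|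
      eq_zero_of_intervalSum_eq_zero (fun i => (e i).2.2) (hfin g) (hcop g) hg
  · rintro _ ⟨g, rfl⟩
    exact AddSubgroup.le_topologicalClosure _ (intervalSum_mem_stepGroup J _)
  · intro a c hac
    choose t ht0 g hg using hsingle
    have ht : Function.Injective t := by
      intro i j hij
      by_contra hne
      have hc := hcop (g i + g j) hne
      simp only [map_add, hg, Finsupp.add_apply, Finsupp.single_eq_same,
        Finsupp.single_eq_of_ne hne, Finsupp.single_eq_of_ne' hne, add_zero, zero_add, hij,
        Nat.coprime_self, AddMonoid.addOrderOf_eq_one_iff] at hc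
      exact ht0 j hc
    let T : AddSubgroup UnitAddCircle := ((intervalSum J).comp X).range.comap (step c - step a)
    have hT : (T : Set UnitAddCircle).Infinite := by
      refine Set.infinite_of_injective_forall_mem (f := fun i => t (e.symm (i, ⟨(a, c), hac⟩)))
        (fun i j hij => congrArg Prod.fst (e.symm.injective (ht hij))) fun i => ?_
      refine ⟨g (e.symm (i, ⟨(a, c), hac⟩)), ?_⟩
      rw [AddMonoidHom.comp_apply, hg, intervalSum_single]
      simp [J]
    exact dense_of_infinite_circle_addSubgroup hT

theorem admitsSSGP_directSum_zmod [Infinite I] {m : I → ℕ} (hm : ∀ i, m i ≠ 1)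
    (hcop : Pairwise fun i j => (m i).Coprime (m j)) : AdmitsSSGP (⨁ i, ZMod (m i)) := by
  classical
  have (i : I) : NeZero (m i) := by
    refine ⟨fun hi => ?_⟩
    obtain ⟨j, hj⟩ := exists_ne i
    exact hm j (by simpa [hi] using hcop hj.symm)
  let X : (⨁ i, ZMod (m i)) →+ (I →₀ UnitAddCircle) :=
    (finsuppAddEquivDFinsupp (ι := I) (M := UnitAddCircle)).symm.toAddMonoidHom.comp
      (DFinsupp.mapRange.addMonoidHom fun i => ZMod.toAddCircle (N := m i))
  have hX (g) (i : I) : X g i = ZMod.toAddCircle (g i) := rfl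
  have htors (g) (i : I) : m i • X g i = 0 := by
    rw [hX, ← map_nsmul, nsmul_eq_mul, CharP.cast_eq_zero, zero_mul, map_zero]
  refine .of_coprime_coordinates (X := X) (fun f g hfg => ?_) (fun g i => ?_) (fun g i j hij => ?_)
    fun i => ?_
  · ext i
    exact ZMod.toAddCircle_injective (m i) (DFunLike.congr_fun hfg i)
  · exact isOfFinAddOrder_iff_nsmul_eq_zero.2 ⟨m i, Nat.pos_of_neZero _, htors g i⟩
  · exact .of_dvd (addOrderOf_dvd_of_nsmul_eq_zero (htors g i))
      (addOrderOf_dvd_of_nsmul_eq_zero (htors g j)) (hcop hij)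
  · have : Nontrivial (ZMod (m i)) := ZMod.nontrivial_iff.2 (hm i)
    refine ⟨ZMod.toAddCircle (1 : ZMod (m i)), ?_, DirectSum.of _ i 1, Finsupp.ext fun j => ?_⟩
    · exact (map_ne_zero_iff _ (ZMod.toAddCircle_injective (m i))).2 one_ne_zero
    · rw [hX]
      rcases eq_or_ne j i with rfl | hj
      · rw [DirectSum.of_eq_same, Finsupp.single_eq_same]
      · rw [DirectSum.of_eq_of_ne _ _ _ hj, map_zero, Finsupp.single_eq_of_ne hj]

end CoprimeCoordinates

section Rational

theorem exists_hom_circle_ne_zero {A : Type*} [AddCommGroup A] {x : A} (hx : x ≠ 0) :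
    ∃ χ : A →+ UnitAddCircle, χ x ≠ 0 := by
  obtain ⟨c, hc⟩ := CharacterModule.exists_character_apply_ne_zero_of_ne_zero hx
  let ι : AddCircle (1 : ℚ) →+ UnitAddCircle :=
    QuotientAddGroup.map _ _ (Rat.castHom ℝ).toAddMonoidHom
      (AddSubgroup.zmultiples_le_of_mem (by simp [AddSubgroup.mem_zmultiples]))
  have hι : Function.Injective ι := by
    refine (injective_iff_map_eq_zero ι).2 fun y hy => ?_
    obtain ⟨q, rfl⟩ := QuotientAddGroup.mk_surjective y
    obtain ⟨n, hn⟩ := (AddCircle.coe_eq_zero_iff 1).1 hy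
    refine (AddCircle.coe_eq_zero_iff 1).2 ⟨n, ?_⟩
    have hnq : (n : ℝ) = (q : ℝ) := by simpa using hn
    simpa using (by exact_mod_cast hnq : (n : ℚ) = q)
  exact ⟨ι.comp c, (map_ne_zero_iff ι hι).2 hc⟩

variable {p : ℕ}

theorem inv_natCast_mem_ratDenomIn {P : Set ℕ} (hp : p.Prime) (hpP : p ∈ P) :
    (p : ℚ)⁻¹ ∈ ratDenomIn P := by
  intro r hr hd
  rw [Rat.inv_natCast_den_of_pos hp.pos, Nat.prime_dvd_prime_iff_eq hr hp] at hd
  exact hd ▸ hpP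

/- Any character that kills all fractions with denominator prime to `p`, but not `1 / p`, works:
every `q` with `p ∣ q.den` has a multiple that differs from `1 / p` by an integer. -/
theorem exists_hom_circle_eq_zero_iff_not_dvd_den (hp : p.Prime) :
    ∃ χ : ℚ →+ UnitAddCircle, ∀ q, χ q = 0 ↔ ¬ p ∣ q.den := by
  have hp0 : (p : ℚ) ≠ 0 := Nat.cast_ne_zero.2 hp.ne_zero
  have hinv : (((p : ℚ)⁻¹ : ℚ) : ℚ ⧸ ratDenomIn {p}ᶜ) ≠ 0 := by
    rw [ne_eq, QuotientAddGroup.eq_zero_iff]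
    exact fun h => h p hp (by rw [Rat.inv_natCast_den_of_pos hp.pos]) rfl
  obtain ⟨χ, hχ⟩ := exists_hom_circle_ne_zero hinv
  have hzero {q : ℚ} (hq : ¬ p ∣ q.den) : χ q = 0 := by
    have hmem : q ∈ ratDenomIn {p}ᶜ := fun r _ hd hr => hq (Set.mem_singleton_iff.1 hr ▸ hd)
    rw [(QuotientAddGroup.eq_zero_iff q).2 hmem, map_zero]
  refine ⟨χ.comp (QuotientAddGroup.mk' _), fun q => ⟨fun (hq : χ q = 0) hd => hχ ?_, hzero⟩⟩
  obtain ⟨d, hd⟩ := hd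
  have hd0 : (d : ℚ) ≠ 0 := by
    rintro h
    exact q.den_nz (by rw [hd, Nat.cast_eq_zero.1 h, mul_zero])
  obtain ⟨u, v, huv⟩ : IsCoprime q.num p :=
    Int.isCoprime_iff_gcd_eq_one.2 (q.reduced.coprime_dvd_right ⟨d, hd⟩)
  have hpinv : (p : ℚ)⁻¹ = (u * d) • q + v := by
    have : (u * q.num + v * p : ℚ) = 1 := by exact_mod_cast huv
    rw [zsmul_eq_mul]
    conv_rhs => rw [← Rat.num_div_den q, hd]
    push_cast
    field_simp
    linarith
  rw [hpinv, QuotientAddGroup.mk_add, map_add, QuotientAddGroup.mk_zsmul, map_zsmul, hq, smul_zero,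
    zero_add, hzero (by simpa using hp.ne_one)]

theorem exists_pow_nsmul_eq_zero (hp : p.Prime) {χ : ℚ →+ UnitAddCircle}
    (hχ : ∀ q, χ q = 0 ↔ ¬ p ∣ q.den) (q : ℚ) : ∃ k, p ^ k • χ q = 0 := by
  obtain ⟨k, m, hm, hden⟩ := Nat.exists_eq_pow_mul_and_not_dvd q.den_nz p hp.ne_one
  refine ⟨k, ?_⟩
  rw [← map_nsmul, hχ]
  have hq : p ^ k • q = Rat.divInt q.num m := by
    have hp0 : (p : ℚ) ≠ 0 := Nat.cast_ne_zero.2 hp.ne_zero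
    rw [nsmul_eq_mul, Rat.divInt_eq_div]
    conv_lhs => rw [← Rat.num_div_den q, hden]
    push_cast
    field_simp
  rw [hq]
  exact fun h => hm (h.trans (Int.natCast_dvd_natCast.1 (Rat.den_dvd _ _)))

theorem exists_hom_finsupp_circle_eq_zero_iff (P : Set ℕ) (hP : ∀ p ∈ P, p.Prime) :
    ∃ X : ℚ →+ (P →₀ UnitAddCircle), ∀ q p, X q p = 0 ↔ ¬ (p : ℕ) ∣ q.den := by
  choose χ hχ using fun p : P => exists_hom_circle_eq_zero_iff_not_dvd_den (hP p p.2)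
  refine ⟨.mk' (fun q => .ofSupportFinite (fun p => χ p q) ?_) fun q r => ?_, fun q p => hχ p q⟩
  · refine ((Set.finite_Iic q.den).preimage Subtype.val_injective.injOn).subset fun p hp => ?_
    exact Nat.le_of_dvd q.den_pos (not_not.1 (mt (hχ p q).2 hp))
  · ext p
    exact map_add (χ p) q r

theorem rat_mem_zmultiples_one_iff {q : ℚ} :
    q ∈ AddSubgroup.zmultiples (1 : ℚ) ↔ q.den = 1 := by
  rw [AddSubgroup.mem_zmultiples_iff, Rat.den_eq_one_iff]
  exact ⟨by rintro ⟨n, rfl⟩; simp, fun h => ⟨q.num, by simpa using h⟩⟩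

variable {P : Set ℕ}

theorem admitsSSGP_ratDenomIn_quotient (hP : {p ∈ P | p.Prime}.Infinite) :
    AdmitsSSGP
      (ratDenomIn P ⧸ (AddSubgroup.zmultiples (1 : ℚ)).addSubgroupOf (ratDenomIn P)) := by
  have : Infinite {p ∈ P | p.Prime} := hP.to_subtype
  obtain ⟨X, hX⟩ := exists_hom_finsupp_circle_eq_zero_iff {p ∈ P | p.Prime} fun p hp => hp.2
  have hker (q : ratDenomIn P) :
      X q = 0 ↔ q ∈ (AddSubgroup.zmultiples (1 : ℚ)).addSubgroupOf (ratDenomIn P) := by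
    rw [AddSubgroup.mem_addSubgroupOf, rat_mem_zmultiples_one_iff,
      Nat.eq_one_iff_not_exists_prime_dvd, DFunLike.ext_iff]
    exact ⟨fun h p hp hd => (hX q ⟨p, q.2 p hp hd, hp⟩).1 (h _) hd,
      fun h p => (hX q p).2 (h p p.2.2)⟩
  let Y := QuotientAddGroup.lift _ (X.comp (ratDenomIn P).subtype) fun q hq => (hker q).2 hq
  have hpow (g) (p : {p ∈ P | p.Prime}) : ∃ k, (p : ℕ) ^ k • Y g p = 0 := by
    obtain ⟨q, rfl⟩ := QuotientAddGroup.mk_surjective g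
    exact exists_pow_nsmul_eq_zero p.2.2 (χ := (Finsupp.applyAddHom p).comp X) (hX · p) q
  refine .of_coprime_coordinates (X := Y) ?_ (fun g p => ?_) (fun g p r hpr => ?_) fun p => ?_
  · refine (injective_iff_map_eq_zero Y).2 fun g hg => ?_
    obtain ⟨q, rfl⟩ := QuotientAddGroup.mk_surjective g
    exact (QuotientAddGroup.eq_zero_iff q).2 ((hker q).1 hg)
  · obtain ⟨k, hk⟩ := hpow g p
    exact isOfFinAddOrder_iff_nsmul_eq_zero.2 ⟨_, pow_pos p.2.2.pos k, hk⟩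
  · obtain ⟨k, hk⟩ := hpow g p
    obtain ⟨l, hl⟩ := hpow g r
    refine .of_dvd (addOrderOf_dvd_of_nsmul_eq_zero hk) (addOrderOf_dvd_of_nsmul_eq_zero hl) ?_
    exact Nat.coprime_pow_primes k l p.2.2 r.2.2 (Subtype.coe_injective.ne hpr)
  · have hX' (r : {p ∈ P | p.Prime}) : X (p : ℚ)⁻¹ r = 0 ↔ r ≠ p := by
      rw [hX, Rat.inv_natCast_den_of_pos p.2.2.pos, Nat.prime_dvd_prime_iff_eq r.2.2 p.2.2,
        Subtype.coe_inj]
    refine ⟨X (p : ℚ)⁻¹ p, fun h => (hX' p).1 h rfl,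
      QuotientAddGroup.mk ⟨_, inv_natCast_mem_ratDenomIn p.2.2 p.2.1⟩, Finsupp.ext fun r => ?_⟩
    change X (p : ℚ)⁻¹ r = _
    rcases eq_or_ne r p with rfl | hr
    · rw [Finsupp.single_eq_same]
    · rw [(hX' r).2 hr, Finsupp.single_eq_of_ne hr]

theorem admitsSSGP_ratDenomIn (hP : {p ∈ P | p.Prime}.Infinite) : AdmitsSSGP (ratDenomIn P) := by
  obtain ⟨p, hpP, hp⟩ := hP.nonempty
  have hp0 : (p : ℚ) ≠ 0 := Nat.cast_ne_zero.2 hp.ne_zero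
  refine .of_quotient (admitsSSGP_ratDenomIn_quotient hP) (n := p) ⟨?_, ?_⟩ ?_
  · exact nsmul_right_injective hp.ne_zero
  · intro q
    have hq : q * (p : ℚ)⁻¹ ∈ ratDenomIn P := fun r hr hd =>
      ((Nat.Prime.dvd_mul hr).1 (hd.trans (Rat.mul_den_dvd _ _))).elim (q.2 r hr)
        (inv_natCast_mem_ratDenomIn hp hpP r hr)
    refine ⟨⟨_, hq⟩, Subtype.ext ?_⟩
    simp [mul_left_comm (p : ℚ), hp0]
  · intro q hq
    obtain ⟨k, hk⟩ := pow_unbounded_of_one_lt |(q : ℚ)| (Nat.one_lt_cast.2 hp.one_lt)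
    obtain ⟨x, ⟨a, ha⟩, rfl⟩ := hq k
    have hx : (x : ℚ) = a := by simpa using ha.symm
    have ha0 : |(a : ℚ)| < 1 := by
      have hpk : (0 : ℚ) < p ^ k := pow_pos (Nat.cast_pos.2 hp.pos) k
      refine lt_of_mul_lt_mul_left ?_ hpk.le
      simpa [hx, abs_mul] using hk
    have : a = 0 := Int.abs_lt_one_iff.1 (by exact_mod_cast ha0)
    have hx0 : x = 0 := Subtype.ext (hx.trans (by simp [this]))
    rw [hx0, smul_zero]

theorem ratDenomIn_primes : ratDenomIn {p | p.Prime} = ⊤ :=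
  (AddSubgroup.eq_top_iff' _).2 fun _ _ hp _ => hp

/-- The identification of `ℚ` with the fractions whose denominators may have any prime factor. -/
noncomputable def ratEquiv : ℚ ≃+ ratDenomIn {p | p.Prime} :=
  AddSubgroup.topEquiv.symm.trans (AddEquiv.addSubgroupCongr ratDenomIn_primes.symm)

theorem admitsSSGP_rat : AdmitsSSGP ℚ :=
  (admitsSSGP_ratDenomIn (by simpa using Nat.infinite_setOfPred_prime)).of_addEquiv ratEquiv

theorem admitsSSGP_rat_quotient : AdmitsSSGP (ℚ ⧸ AddSubgroup.zmultiples (1 : ℚ)) := by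
  refine (admitsSSGP_ratDenomIn_quotient (P := {p | p.Prime})
    (by simpa using Nat.infinite_setOfPred_prime)).of_addEquiv
      (QuotientAddGroup.congr _ _ ratEquiv ?_)
  ext q
  exact AddSubgroup.mem_map_equiv

end Rational

section FinitePower

variable (n : ℕ) (Λ : Type*)

/-- The restriction to `Λ`, modulo `n`, of the continuous functions `β Λ → ℤ`, where `β Λ` is
encoded as the space of ultrafilters on `Λ`. -/
noncomputable def restrictMod : LocallyConstant (Ultrafilter Λ) ℤ →ₗ[ℤ] (Λ → ZMod n) :=
  LinearMap.pi fun x => (Int.castAddHom (ZMod n)).toIntLinearMap ∘ₗ LocallyConstant.evalₗ ℤ (pure x)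

theorem ker_restrictMod :
    LinearMap.ker (restrictMod n Λ) =
      LinearMap.range (LinearMap.lsmul ℤ (LocallyConstant (Ultrafilter Λ) ℤ) n) := by
  ext f
  constructor
  · intro hf
    refine ⟨f.map (· / n), LocallyConstant.ext fun u => ?_⟩
    obtain ⟨x, hx⟩ := denseRange_pure.exists_mem_open (f.isLocallyConstant.isOpen_fiber (f u))
      ⟨u, rfl⟩
    have hd : (n : ℤ) ∣ f (pure x) := (ZMod.intCast_zmod_eq_zero_iff_dvd _ n).1 (congrFun hf x)
    rw [Set.mem_ofPred_eq] at hx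
    exact Int.mul_ediv_cancel' (hx ▸ hd)
  · rintro ⟨g, rfl⟩
    refine funext fun x => ?_
    change (((n : ℤ) * g (pure x) : ℤ) : ZMod n) = 0
    simp

variable [NeZero n]

theorem restrictMod_surjective : Function.Surjective (restrictMod n Λ) := by
  intro h
  let : TopologicalSpace (ZMod n) := ⊥
  have : DiscreteTopology (ZMod n) := ⟨rfl⟩
  let k : LocallyConstant (Ultrafilter Λ) (ZMod n) := ⟨Ultrafilter.extend h,
    (IsLocallyConstant.iff_continuous _).2 (continuous_ultrafilter_extend h)⟩
  refine ⟨k.map fun a => (a.val : ℤ), funext fun x => ?_⟩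
  calc (((k (pure x)).val : ℤ) : ZMod n) = k (pure x) := by simp
    _ = h x := congrFun (ultrafilter_extend_extends h) x

/- The continuous functions `β Λ → ℤ` form a free group by Nöbeling's theorem. -/
theorem exists_pi_zmod_addEquiv_finsupp (Λ : Type u₁) :
    ∃ ι : Type u₁, Nonempty ((Λ → ZMod n) ≃+ (ι →₀ ZMod n)) := by
  have : Module.Free ℤ (LocallyConstant (Ultrafilter Λ) ℤ) :=
    LocallyConstant.freeOfProfinite (Profinite.of (Ultrafilter Λ))
  let b := ModN.basis (n := n) (Module.Free.chooseBasis ℤ (LocallyConstant (Ultrafilter Λ) ℤ))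
  let e := (Submodule.quotEquivOfEq _ _ (ker_restrictMod n Λ)).symm ≪≫ₗ
    LinearMap.quotKerEquivOfSurjective _ (restrictMod_surjective n Λ)
  exact ⟨_, ⟨e.symm.toAddEquiv.trans b.repr.toAddEquiv⟩⟩

theorem admitsSSGP_pi_zmod [Infinite Λ] {n : ℕ} (hn : 1 < n) : AdmitsSSGP (Λ → ZMod n) := by
  have : NeZero n := ⟨hn.ne_bot⟩
  have : Fact (1 < n) := ⟨hn⟩
  obtain ⟨ι, ⟨e⟩⟩ := exists_pi_zmod_addEquiv_finsupp n Λ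
  have : Infinite ι := by
    by_contra! hι
    have := Finite.of_injective (DFunLike.coe ∘ e) (DFunLike.coe_injective.comp e.injective)
    exact not_finite (Λ → ZMod n)
  exact (admitsSSGP_finsupp ι (ZMod n)).of_addEquiv e

theorem admitsSSGP_pi_of_finite [Infinite Λ] (F : Type*) [AddCommGroup F] [Finite F] :
    AdmitsSSGP (Λ → F) := by
  classical
  obtain ⟨ι, _, n, hn, ⟨e⟩⟩ := AddCommGroup.equiv_directSum_zmod_of_finite' F
  let e' : F ≃+ ∀ i, ZMod (n i) := e.trans (DirectSum.addEquivProd _)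
  refine (AdmitsSSGP.pi fun i => admitsSSGP_pi_zmod Λ (hn i)).of_addEquiv
    (.mk' ((Equiv.arrowCongr (.refl Λ) e'.toEquiv).trans (Equiv.piComm _)) fun f g => ?_)
  ext i x
  exact congrFun (map_add e' (f x) (g x)) i

end FinitePower

theorem mainTheorem9_general :
    (AdmitsSSGP ℚ ∧
      ∀ P : Set ℕ, {p ∈ P | p.Prime}.Infinite → AdmitsSSGP (ratDenomIn P)) ∧
    (AdmitsSSGP (ℚ ⧸ AddSubgroup.zmultiples (1 : ℚ)) ∧
      ∀ P : Set ℕ, {p ∈ P | p.Prime}.Infinite →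
        AdmitsSSGP
          (ratDenomIn P ⧸ (AddSubgroup.zmultiples (1 : ℚ)).addSubgroupOf (ratDenomIn P))) ∧
    (∀ m : ℕ → ℕ, ((∀ i j, m i = m j) ∨
        (∀ i, m i ≠ 1) ∧ Pairwise fun i j => (m i).Coprime (m j)) →
      AdmitsSSGP (⨁ i, ZMod (m i))) ∧
    (∀ (A : Type*) [AddCommGroup A] [IsAddTorsionFree A], Cardinal.aleph0 ≤ Module.rank ℤ A →
      AdmitsSSGP A) ∧
    (∀ (G : Type u₁) [AddCommGroup G] (Λ : Type u₂) [Infinite Λ], AdmitsSSGP (Λ →₀ G)) ∧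
    (∀ (F : Type u₃) [AddCommGroup F] [Finite F] (Λ : Type u₄) [Infinite Λ],
      AdmitsSSGP (Λ → F)) ∧
    (∀ (I : Type u₅) (G : I → Type u₆) [∀ i, AddCommGroup (G i)],
      (∀ i, AdmitsSSGP (G i)) → AdmitsSSGP (⨁ i, G i) ∧ AdmitsSSGP (∀ i, G i)) := by
  refine ⟨⟨admitsSSGP_rat, fun P => admitsSSGP_ratDenomIn⟩,
    ⟨admitsSSGP_rat_quotient, fun P => admitsSSGP_ratDenomIn_quotient⟩, ?_,
    fun A _ _ => admitsSSGP_of_aleph0_le_rank, fun G _ Λ _ => admitsSSGP_finsupp Λ G,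
    fun F _ _ Λ _ => admitsSSGP_pi_of_finite Λ F, fun I G _ hG => ⟨.directSum hG, .pi hG⟩⟩
  rintro m (heq | ⟨hm, hcop⟩)
  · obtain ⟨n, rfl⟩ : ∃ n, m = fun _ => n := ⟨m 0, funext fun i => heq i 0⟩
    exact (admitsSSGP_finsupp ℕ (ZMod n)).of_addEquiv
      (finsuppAddEquivDFinsupp (ι := ℕ) (M := ZMod n)).symm
  · exact admitsSSGP_directSum_zmod hm hcop

theorem mainTheorem9 :
    -- `ℚ`, and its subgroups with infinitely many primes and their powers as denominators
    (AdmitsSSGP ℚ ∧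
      ∀ P : Set ℕ, (∀ p ∈ P, p.Prime) → P.Infinite → AdmitsSSGP (ratDenomIn P)) ∧
    -- the quotients of these groups by `ℤ`
    (AdmitsSSGP (ℚ ⧸ AddSubgroup.zmultiples (1 : ℚ)) ∧
      ∀ P : Set ℕ, (∀ p ∈ P, p.Prime) → P.Infinite →
        AdmitsSSGP
          (ratDenomIn P ⧸ (AddSubgroup.zmultiples (1 : ℚ)).addSubgroupOf (ratDenomIn P))) ∧
    -- direct sums of cyclic groups of prime orders that all coincide or all differ
    (∀ p : ℕ → ℕ, (∀ i, (p i).Prime) → ((∀ i j, p i = p j) ∨ Function.Injective p) →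
      AdmitsSSGP (⨁ i, ZMod (p i))) ∧
    -- `ℤ^(ω)` and `ℤ^ω`
    AdmitsSSGP (ℕ →₀ ℤ) ∧
    AdmitsSSGP (ℕ → ℤ) ∧
    -- `G^(Λ)`
    (∀ (G : Type u₁) [AddCommGroup G] [Nontrivial G] (Λ : Type u₂) [Infinite Λ],
      AdmitsSSGP (Λ →₀ G)) ∧
    -- `F^Λ`
    (∀ (F : Type u₃) [AddCommGroup F] [Nontrivial F] [Finite F] (Λ : Type u₄) [Infinite Λ],
      AdmitsSSGP (Λ → F)) ∧
    -- arbitrary direct sums and products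
    (∀ (I : Type u₅) (G : I → Type u₆) [∀ i, AddCommGroup (G i)],
      (∀ i, AdmitsSSGP (G i)) → AdmitsSSGP (⨁ i, G i) ∧ AdmitsSSGP (∀ i, G i)) := by
  obtain ⟨⟨hℚ, hP⟩, ⟨hℚ', hP'⟩, hm, hA, hG, hF, hI⟩ := mainTheorem9_general
  have primes {P : Set ℕ} (h : ∀ p ∈ P, p.Prime) (hinf : P.Infinite) :
      {p ∈ P | p.Prime}.Infinite := hinf.mono fun p hp => ⟨hp, h p hp⟩
  exact ⟨⟨hℚ, fun P h hinf => hP P (primes h hinf)⟩,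
    ⟨hℚ', fun P h hinf => hP' P (primes h hinf)⟩,
    fun p hp h => hm p (h.imp_right fun hinj => ⟨fun i => (hp i).ne_one,
      fun i j hij => (Nat.coprime_primes (hp i) (hp j)).2 (hinj.ne hij)⟩),
    admitsSSGP_finsupp ℕ ℤ,
    hA (ℕ → ℤ) (Pi.linearIndependent_single_one ℕ ℤ).aleph0_le_rank,
    fun G _ _ Λ _ => hG G Λ, fun F _ _ _ Λ _ => hF F Λ, hI⟩
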